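/- Let $Q$ be a smooth manifold of dimension $n$, let $k$ be a natural number, and let $\tau_Q:T^1_kQ=TQ\oplus\overset{k}{\cdots}\oplus TQ\to Q$ and $\tau_Q^*:(T^1_k)^*Q=T^*Q\oplus\overset{k}{\cdots}\oplus T^*Q\to Q$ be the Whitney sums of $k$ copies of the tangent and of the cotangent bundle. For a smooth map $F:M\to N$ write $T^1_k(F):T^1_kM\to T^1_kN$, $(v_1,\dots,v_k)\mapsto(F_*v_1,\dots,F_*v_k)$. A $k$-vector field on $M$ is a smooth section $\mathbf X=(X_1,\dots,X_k)$ of $T^1_kM\to M$; a $k$-vector field along $F$ is a smooth map $\mathcal K=(\mathcal K_1,\dots,\mathcal K_k):M\to T^1_kN$ lying over $F$. On $(T^1_k)^*Q$ let $(\omega_0)_A=-d\big((\tau^*_A)^*\theta_0\big)$, $1\le A\le k$, where $\tau^*_A:(T^1_k)^*Q\to T^*Q$ is the projection onto the $A$-th copy and $\theta_0$ is the Liouville $1$-form of $T^*Q$. Let $L:T^1_kQ\to\mathbb R$ be a smooth function (a Lagrangian). Its Legendre map $FL:T^1_kQ\to(T^1_k)^*Q$ is $$[FL(v_1,\dots,v_k)]^A(w)=\frac{d}{ds}\Big|_{s=0}L(v_1,\dots,v_A+sw,\dots,v_k);$$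 its energy is $E_L=C(L)-L$, where $C$ is the generator of the flow $v\mapsto e^sv$; and $(\omega_L)_A=-d(dL\circ S^A)$, where $S^A(v)(Z)=\frac{d}{ds}\big|_{s=0}\big(v_1,\dots,v_A+s(\tau_Q)_*Z,\dots,v_k\big)$. Let $\mathcal K$ be a $k$-vector field along $FL$, let $\mathbf X_L=((X_L)_1,\dots,(X_L)_k)$ be a $k$-vector field on $T^1_kQ$, and let $S\subseteq T^1_kQ$ be a subset (for instance a submanifold) such that $T^1_k(FL)\circ\mathbf X_L=\mathcal K$ at all points of $S$. Then the following are equivalent: 1. $\mathcal K$ is a field operator for $L$ on $S$, that is, at every $v\in S$ it satisfies the field equation condition $$\sum_{A=1}^k(\omega_0)_A\big(\mathcal K_A(v),(FL)_*Z\big)=dE_L(v)(Z)\qquad\text{for all } Z\in T_v(T^1_kQ),$$ that is, $\sum_A(FL)^*[\imath_{\mathcal K_A}((\omega_0)_A\circ FL)]=dE_L$ at $v$, and the second-order condition $T^1_k(\tau_Q^*)(\mathcal K(v))=v$; 2. on $S$, $\mathbf X_L$ is a SOPDE that solves the Lagrangian field equation, that is, at every $v\in S$ one has $T^1_k(\tau_Q)(\mathbf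 X_L(v))=v$ and $\sum_{A=1}^k\imath_{(X_L)_A}(\omega_L)_A=dE_L$ as covectors on $T_v(T^1_kQ)$. In particular, for $S=T^1_kQ$: $\mathcal K$ is a field operator for $L$ if and only if $\mathbf X_L$ is a SOPDE solving the Lagrangian field equation. -/

import Mathlib

open Bundle
open scoped Manifold ContDiff

noncomputable section

namespace KSymplectic

/-! ### Whitney powers and duals of vector bundles given by transition functions -/

section Core

variable {B : Type*} [TopologicalSpace B] {F : Type*} [NormedAddCommGroup F] [NormedSpace ℝ F]
  {ι : Type*}

/-- The operator on `F ⊕ ⋯ ⊕ F` acting by `T` on each summand. -/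
def diagMap (k : ℕ) (T : F →L[ℝ] F) : (Fin k → F) →L[ℝ] (Fin k → F) :=
  ContinuousLinearMap.piMap fun _ => T

/-- `diagMap` as a continuous linear map in `T`. -/
def diagMapL (F : Type*) [NormedAddCommGroup F] [NormedSpace ℝ F] (k : ℕ) :
    (F →L[ℝ] F) →L[ℝ] ((Fin k → F) →L[ℝ] (Fin k → F)) :=
  ∑ A : Fin k,
    (ContinuousLinearMap.compL ℝ (Fin k → F) F (Fin k → F)
      (ContinuousLinearMap.single ℝ (fun _ : Fin k => F) A)) ∘L
      ((ContinuousLinearMap.compL ℝ (Fin k → F) F F).flip (ContinuousLinearMap.proj A))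

theorem diagMapL_apply (k : ℕ) (T : F →L[ℝ] F) : diagMapL F k T = diagMap k T := by
  ext v A
  simp [diagMapL, diagMap, Finset.sum_apply, Pi.single_apply]

/-- The Whitney sum of `k` copies of a vector bundle. -/
def whitneyPower (k : ℕ) (Z : VectorBundleCore ℝ B F ι) :
    VectorBundleCore ℝ B (Fin k → F) ι where
  baseSet := Z.baseSet
  isOpen_baseSet := Z.isOpen_baseSet
  indexAt := Z.indexAt
  mem_baseSet_at := Z.mem_baseSet_at
  coordChange i j b := diagMap k (Z.coordChange i j b)
  coordChange_self i b hb v := by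
    ext A
    exact Z.coordChange_self i b hb (v A)
  continuousOn_coordChange i j := by
    simp only [← diagMapL_apply]
    exact (diagMapL F k).continuous.comp_continuousOn (Z.continuousOn_coordChange i j)
  coordChange_comp i j l b hb v := by
    ext A
    exact Z.coordChange_comp i j l b hb (v A)

/-- The transpose `T ↦ (φ ↦ φ ∘ T)`. -/
def precompL (F : Type*) [NormedAddCommGroup F] [NormedSpace ℝ F] :
    (F →L[ℝ] F) →L[ℝ] ((F →L[ℝ] ℝ) →L[ℝ] (F →L[ℝ] ℝ)) :=
  (ContinuousLinearMap.compL ℝ F F ℝ).flip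

theorem precompL_apply (T : F →L[ℝ] F) (φ : F →L[ℝ] ℝ) (v : F) :
    precompL F T φ v = φ (T v) := rfl

/-- The dual of a vector bundle: a covector `φ` read in the trivialization `i` is
`φ ∘ (i ← j)` in the trivialization `j`. -/
def dualCore (Z : VectorBundleCore ℝ B F ι) : VectorBundleCore ℝ B (F →L[ℝ] ℝ) ι where
  baseSet := Z.baseSet
  isOpen_baseSet := Z.isOpen_baseSet
  indexAt := Z.indexAt
  mem_baseSet_at := Z.mem_baseSet_at
  coordChange i j b := precompL F (Z.coordChange j i b)
  coordChange_self i b hb φ := by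
    ext v
    simp [precompL_apply, Z.coordChange_self i b hb v]
  continuousOn_coordChange i j := by
    refine (precompL F).continuous.comp_continuousOn ?_
    rw [Set.inter_comm]
    exact Z.continuousOn_coordChange j i
  coordChange_comp i j l b hb φ := by
    ext v
    simp [precompL_apply, Z.coordChange_comp l j i b ⟨⟨hb.2, hb.1.2⟩, hb.1.1⟩ v]

variable {E H : Type*} [NormedAddCommGroup E] [NormedSpace ℝ E] [TopologicalSpace H]
  [ChartedSpace H B] (I : ModelWithCorners ℝ E H)

theorem whitneyPower_isContMDiff (k : ℕ) (Z : VectorBundleCore ℝ B F ι)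
    (h : Z.IsContMDiff I ∞) : (whitneyPower k Z).IsContMDiff I ∞ where
  contMDiffOn_coordChange i j := by
    have e : (whitneyPower k Z).coordChange i j = diagMapL F k ∘ Z.coordChange i j := by
      funext b
      exact (diagMapL_apply k _).symm
    rw [e]
    exact (diagMapL F k).contMDiff.comp_contMDiffOn (h.contMDiffOn_coordChange i j)

set_option synthInstance.maxHeartbeats 200000 in
theorem dualCore_isContMDiff (Z : VectorBundleCore ℝ B F ι)
    (h : Z.IsContMDiff I ∞) : (dualCore Z).IsContMDiff I ∞ where
  contMDiffOn_coordChange i j := by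
    have e : (dualCore Z).coordChange i j =
      precompL F ∘ Z.coordChange j i := rfl
    rw [e]
    have hc : ContDiff ℝ ∞ (precompL F) := by fun_prop
    refine hc.contMDiff.comp_contMDiffOn ?_
    exact (h.contMDiffOn_coordChange j i).mono fun b hb => ⟨hb.2, hb.1⟩

end Core

section Bundles

variable {E H : Type*} [NormedAddCommGroup E] [NormedSpace ℝ E] [TopologicalSpace H]
  (k : ℕ) (I : ModelWithCorners ℝ E H) {M : Type*} [TopologicalSpace M] [ChartedSpace H M]

/-! ### The tangent bundle of `k¹`-velocities `T¹ₖM = TM ⊕ ⋯ ⊕ TM` -/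

/-- The fibre of `T¹ₖM` over `x`: `k`-tuples of tangent vectors at `x`. -/
def VelocitySpace (x : M) : Type _ := Fin k → TangentSpace I x

/-- The fibre of `T*M` over `x`: linear forms on the tangent space. -/
def CovectorSpace (x : M) : Type _ := TangentSpace I x →L[ℝ] ℝ

/-- The fibre of `(T¹ₖ)*M` over `x`: `k`-tuples of covectors at `x`. -/
def CovelocitySpace (x : M) : Type _ := Fin k → (TangentSpace I x →L[ℝ] ℝ)

instance (x : M) : TopologicalSpace (VelocitySpace k I x) :=
  inferInstanceAs (TopologicalSpace (Fin k → E))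
instance (x : M) : AddCommGroup (VelocitySpace k I x) :=
  inferInstanceAs (AddCommGroup (Fin k → E))
instance (x : M) : Module ℝ (VelocitySpace k I x) :=
  inferInstanceAs (Module ℝ (Fin k → E))
instance (x : M) : TopologicalSpace (CovectorSpace I x) :=
  inferInstanceAs (TopologicalSpace (E →L[ℝ] ℝ))
instance (x : M) : AddCommGroup (CovectorSpace I x) :=
  inferInstanceAs (AddCommGroup (E →L[ℝ] ℝ))
instance (x : M) : Module ℝ (CovectorSpace I x) :=
  inferInstanceAs (Module ℝ (E →L[ℝ] ℝ))
instance (x : M) : TopologicalSpace (CovelocitySpace k I x) :=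
  inferInstanceAs (TopologicalSpace (Fin k → (E →L[ℝ] ℝ)))
instance (x : M) : AddCommGroup (CovelocitySpace k I x) :=
  inferInstanceAs (AddCommGroup (Fin k → (E →L[ℝ] ℝ)))
instance (x : M) : Module ℝ (CovelocitySpace k I x) :=
  inferInstanceAs (Module ℝ (Fin k → (E →L[ℝ] ℝ)))

variable (M) in
/-- `T¹ₖM`, the Whitney sum of `k` copies of `TM`. -/
abbrev VelocityBundle : Type _ := TotalSpace (Fin k → E) (VelocitySpace k I : M → Type _)

variable (M) in
/-- The cotangent bundle `T*M`. -/
abbrev Cotangent : Type _ := TotalSpace (E →L[ℝ] ℝ) (CovectorSpace I : M → Type _)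

variable (M) in
/-- `(T¹ₖ)*M`, the Whitney sum of `k` copies of `T*M`. -/
abbrev CovelocityBundle : Type _ :=
  TotalSpace (Fin k → (E →L[ℝ] ℝ)) (CovelocitySpace k I : M → Type _)

/-- The model of the manifold `T¹ₖM`. -/
abbrev velModel : ModelWithCorners ℝ (E × (Fin k → E)) (ModelProd H (Fin k → E)) :=
  I.prod 𝓘(ℝ, Fin k → E)

/-- The model of the manifold `T*M`. -/
abbrev cotModel : ModelWithCorners ℝ (E × (E →L[ℝ] ℝ)) (ModelProd H (E →L[ℝ] ℝ)) :=
  I.prod 𝓘(ℝ, E →L[ℝ] ℝ)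

/-- The model of the manifold `(T¹ₖ)*M`. -/
abbrev covelModel :
    ModelWithCorners ℝ (E × (Fin k → (E →L[ℝ] ℝ))) (ModelProd H (Fin k → (E →L[ℝ] ℝ))) :=
  I.prod 𝓘(ℝ, Fin k → (E →L[ℝ] ℝ))

variable [IsManifold I ∞ M]

theorem tangentBundleCore_isContMDiff_infty : (tangentBundleCore I M).IsContMDiff I ∞ := by
  have : IsManifold I (∞ + 1) M := ‹IsManifold I ∞ M›
  exact tangentBundleCore.isContMDiff

instance : TopologicalSpace (VelocityBundle k I M) :=
  inferInstanceAs <| TopologicalSpace (whitneyPower k (tangentBundleCore I M)).TotalSpace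
instance : FiberBundle (Fin k → E) (VelocitySpace k I : M → Type _) :=
  inferInstanceAs <| FiberBundle (Fin k → E) (whitneyPower k (tangentBundleCore I M)).Fiber
instance : VectorBundle ℝ (Fin k → E) (VelocitySpace k I : M → Type _) :=
  inferInstanceAs <| VectorBundle ℝ (Fin k → E) (whitneyPower k (tangentBundleCore I M)).Fiber
instance : ContMDiffVectorBundle ∞ (Fin k → E) (VelocitySpace k I : M → Type _) I := by
  have := whitneyPower_isContMDiff I k _ (tangentBundleCore_isContMDiff_infty (M := M) I)
  exact (whitneyPower k (tangentBundleCore I M)).instContMDiffVectorBundle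

instance : TopologicalSpace (Cotangent I M) :=
  inferInstanceAs <| TopologicalSpace (dualCore (tangentBundleCore I M)).TotalSpace
instance : FiberBundle (E →L[ℝ] ℝ) (CovectorSpace I : M → Type _) :=
  inferInstanceAs <| FiberBundle (E →L[ℝ] ℝ) (dualCore (tangentBundleCore I M)).Fiber
instance : VectorBundle ℝ (E →L[ℝ] ℝ) (CovectorSpace I : M → Type _) :=
  inferInstanceAs <| VectorBundle ℝ (E →L[ℝ] ℝ) (dualCore (tangentBundleCore I M)).Fiber
instance : ContMDiffVectorBundle ∞ (E →L[ℝ] ℝ) (CovectorSpace I : M → Type _) I := by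
  have := dualCore_isContMDiff I _ (tangentBundleCore_isContMDiff_infty (M := M) I)
  exact (dualCore (tangentBundleCore I M)).instContMDiffVectorBundle

instance : TopologicalSpace (CovelocityBundle k I M) :=
  inferInstanceAs <|
    TopologicalSpace (whitneyPower k (dualCore (tangentBundleCore I M))).TotalSpace
instance : FiberBundle (Fin k → (E →L[ℝ] ℝ)) (CovelocitySpace k I : M → Type _) :=
  inferInstanceAs <| FiberBundle (Fin k → (E →L[ℝ] ℝ))
    (whitneyPower k (dualCore (tangentBundleCore I M))).Fiber
instance : VectorBundle ℝ (Fin k → (E →L[ℝ] ℝ)) (CovelocitySpace k I : M → Type _) :=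
  inferInstanceAs <| VectorBundle ℝ (Fin k → (E →L[ℝ] ℝ))
    (whitneyPower k (dualCore (tangentBundleCore I M))).Fiber
instance :
    ContMDiffVectorBundle ∞ (Fin k → (E →L[ℝ] ℝ)) (CovelocitySpace k I : M → Type _) I := by
  have := whitneyPower_isContMDiff I k _
    (dualCore_isContMDiff I _ (tangentBundleCore_isContMDiff_infty (M := M) I))
  exact (whitneyPower k (dualCore (tangentBundleCore I M))).instContMDiffVectorBundle

end Bundles

/-! ### Differential forms and `k`-vector fields on a manifold -/

section Manifold

variable {E H : Type*} [NormedAddCommGroup E] [NormedSpace ℝ E] [TopologicalSpace H]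
  {I : ModelWithCorners ℝ E H} {M : Type*} [TopologicalSpace M] [ChartedSpace H M]
  {E' H' : Type*} [NormedAddCommGroup E'] [NormedSpace ℝ E'] [TopologicalSpace H']
  {I' : ModelWithCorners ℝ E' H'} {N : Type*} [TopologicalSpace N] [ChartedSpace H' N]

variable (I M) in
/-- Fields of linear forms on `M`. -/
abbrev OneForm : Type _ := (x : M) → TangentSpace I x →L[ℝ] ℝ

variable (I M) in
/-- Fields of alternating bilinear forms on `M`. -/
abbrev TwoForm : Type _ := (x : M) → TangentSpace I x [⋀^Fin 2]→L[ℝ] ℝ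

/-- The pull-back `F*α` of a 1-form. -/
def pullback (F : M → N) (α : OneForm I' N) : OneForm I M :=
  fun x => (α (F x)).comp (mfderiv I I' F x)

/-- The expression of a 1-form in the chart at `x₀`: its pull-back by the inverse of the chart. -/
def formInChart (α : OneForm I M) (x₀ : M) (z : E) : E [⋀^Fin 1]→L[ℝ] ℝ :=
  ContinuousAlternatingMap.ofSubsingleton ℝ E ℝ (0 : Fin 1)
    ((α ((extChartAt I x₀).symm z)).comp (mfderiv 𝓘(ℝ, E) I (extChartAt I x₀).symm z))

/-- The exterior derivative `dα` of a 1-form on a manifold without boundary: at `x`, the exterior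
derivative of the expression of `α` in the chart at `x`, pulled back by the chart. -/
def extDerivForm [I.Boundaryless] (α : OneForm I M) : TwoForm I M :=
  fun x => (extDeriv (formInChart α x) (extChartAt I x x)).compContinuousLinearMap
    (mfderiv I 𝓘(ℝ, E) (extChartAt I x) x)

/-- The map `T¹ₖ(F) : T¹ₖM → T¹ₖN`, `(v₁, …, v_k) ↦ (F_* v₁, …, F_* v_k)`. -/
def velMap (k : ℕ) (F : M → N) (p : VelocityBundle k I M) : VelocityBundle k I' N :=
  ⟨F p.proj, fun A => mfderiv I I' F p.proj (p.snd A)⟩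

variable (I M) in
/-- A `k`-vector field on `M`: a smooth section of `T¹ₖM → M`. -/
structure KVectorField (k : ℕ) [IsManifold I ∞ M] where
  /-- the vectors `X₁(x), …, X_k(x)` -/
  toFun : ∀ x : M, VelocitySpace k I x
  smooth : ContMDiff I (velModel k I) ∞ (fun x => (⟨x, toFun x⟩ : VelocityBundle k I M))

variable (I I') in
/-- A `k`-vector field along `F : M → N`: a smooth map `K : M → T¹ₖN` which lies over `F`. -/
structure KVectorFieldAlong (k : ℕ) [IsManifold I' ∞ N] (F : M → N) where
  /-- the vectors `K₁(x), …, K_k(x)`, tangent to `N` at `F x` -/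
  toFun : ∀ x : M, VelocitySpace k I' (F x)
  smooth : ContMDiff I (velModel k I') ∞ (fun x => (⟨F x, toFun x⟩ : VelocityBundle k I' N))

/-- A `k`-vector field as a map `M → T¹ₖM`. -/
def KVectorField.toMap {k : ℕ} [IsManifold I ∞ M] (X : KVectorField I M k) (x : M) :
    VelocityBundle k I M := ⟨x, X.toFun x⟩

/-- A `k`-vector field along `F` as a map `M → T¹ₖN`. -/
def KVectorFieldAlong.toMap {k : ℕ} [IsManifold I' ∞ N] {F : M → N}
    (K : KVectorFieldAlong I I' k F) (x : M) : VelocityBundle k I' N := ⟨F x, K.toFun x⟩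

/-- The `A`-th component `X_A` of a `k`-vector field. -/
def KVectorField.comp {k : ℕ} [IsManifold I ∞ M] (X : KVectorField I M k) (A : Fin k) (x : M) :
    TangentSpace I x := X.toFun x A

/-- The `A`-th component `K_A` of a `k`-vector field along `F`. -/
def KVectorFieldAlong.comp {k : ℕ} [IsManifold I' ∞ N] {F : M → N}
    (K : KVectorFieldAlong I I' k F) (A : Fin k) (x : M) : TangentSpace I' (F x) := K.toFun x A

end Manifold

/-! ### Canonical structures and the Lagrangian formalism -/

section Dynamics

variable {E H : Type*} [NormedAddCommGroup E] [NormedSpace ℝ E] [TopologicalSpace H]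
  {k : ℕ} {I : ModelWithCorners ℝ E H} {Q : Type*} [TopologicalSpace Q] [ChartedSpace H Q]
  [IsManifold I ∞ Q]

/-- The projection `τ_Q : T¹ₖQ → Q`. -/
def velProj (v : VelocityBundle k I Q) : Q := v.proj

/-- The vectors `(v₁, …, v_k)` of a point `v` of `T¹ₖQ`. -/
def velTuple (v : VelocityBundle k I Q) : Fin k → E := v.snd

/-- The projection `τ* : T*Q → Q`. -/
def cotProj (α : Cotangent I Q) : Q := α.proj

/-- The linear form on `T_qQ` that a point of `T*Q` over `q` is. -/
def cotForm (α : Cotangent I Q) : TangentSpace I (cotProj α) →L[ℝ] ℝ := α.snd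

/-- The projection `τ*_Q : (T¹ₖ)*Q → Q`. -/
def covelProj (p : CovelocityBundle k I Q) : Q := p.proj

/-- The projection `τ*_A : (T¹ₖ)*Q → T*Q` onto the `A`-th copy. -/
def covelComponent (A : Fin k) (p : CovelocityBundle k I Q) : Cotangent I Q :=
  ⟨p.proj, p.snd A⟩

variable (I Q) in
/-- The Liouville form of `T*Q`: `θ₀(α)(Z) = α(τ*_* Z)`. -/
def liouvilleForm : OneForm (cotModel I) (Cotangent I Q) :=
  fun α => (cotForm α).comp (mfderiv (cotModel I) I cotProj α)

variable (I Q) in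
/-- `(θ₀)_A = (τ*_A)* θ₀`. -/
def theta0 (A : Fin k) : OneForm (covelModel k I) (CovelocityBundle k I Q) :=
  pullback (covelComponent A) (liouvilleForm I Q)

variable (I Q) in
/-- The canonical polysymplectic structure `(ω₀)_A = -d(θ₀)_A` of `(T¹ₖ)*Q`. -/
def omega0 [I.Boundaryless] (A : Fin k) : TwoForm (covelModel k I) (CovelocityBundle k I Q) :=
  fun p => -extDerivForm (theta0 I Q A) p

/-- The vertical `A`-lift at `v = (v₁, …, v_k)`, sending `X ∈ T_qQ` to the velocity at `s = 0` of
`s ↦ (v₁, …, v_A + s X, …, v_k)`; it is written as the derivative of the inclusion of the fibre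
over `q`, in the direction `(0, …, X, …, 0)`. -/
def verticalLift (A : Fin k) (v : VelocityBundle k I Q) :
    TangentSpace I (velProj v) →L[ℝ] TangentSpace (velModel k I) v :=
  (mfderiv 𝓘(ℝ, Fin k → E) (velModel k I)
    (fun u : Fin k → E => (⟨v.proj, u⟩ : VelocityBundle k I Q)) (velTuple v)).comp
    (ContinuousLinearMap.single ℝ (fun _ : Fin k => E) A)

/-- The canonical `k`-tangent structure `S^A(v)(Z) = ((τ_Q)_* Z)^A`. -/
def tangentStructure (A : Fin k) (v : VelocityBundle k I Q) :
    TangentSpace (velModel k I) v →L[ℝ] TangentSpace (velModel k I) v :=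
  (verticalLift A v).comp (mfderiv (velModel k I) I velProj v)

variable (L : VelocityBundle k I Q → ℝ)

/-- `(θ_L)_A = dL ∘ S^A`. -/
def thetaL (A : Fin k) : OneForm (velModel k I) (VelocityBundle k I Q) :=
  fun v => (mvfderiv (velModel k I) L v).comp (tangentStructure A v)

/-- `(ω_L)_A = -d(θ_L)_A`. -/
def omegaL [I.Boundaryless] (A : Fin k) : TwoForm (velModel k I) (VelocityBundle k I Q) :=
  fun v => -extDerivForm (thetaL L A) v

/-- The energy `E_L = C(L) - L`, where `C` is the Liouville vector field, the generator of the
flow `v ↦ eˢ v`. -/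
def energy (v : VelocityBundle k I Q) : ℝ :=
  deriv (fun s : ℝ => L ⟨v.proj, Real.exp s • v.snd⟩) 0 - L v

/-- The Legendre map `FL : T¹ₖQ → (T¹ₖ)*Q`,
`FL(v)^A(w) = d/ds L(v₁, …, v_A + s w, …, v_k)` at `s = 0`, written as the Fréchet derivative of
`L` along the fibre through `v`, in the direction `(0, …, w, …, 0)`. -/
def legendre (v : VelocityBundle k I Q) : CovelocityBundle k I Q :=
  ⟨v.proj, fun A => (fderiv ℝ (fun u : Fin k → E => L ⟨v.proj, u⟩) (velTuple v)).comp
    (ContinuousLinearMap.single ℝ (fun _ : Fin k => E) A)⟩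

variable {L}

/-- `X` is a second order partial differential equation (SOPDE) at the points of `S`:
`T¹ₖ(τ_Q) ∘ X = Id`. -/
def IsSopdeOn (X : KVectorField (velModel k I) (VelocityBundle k I Q) k)
    (S : Set (VelocityBundle k I Q)) : Prop :=
  ∀ v ∈ S, velMap (I' := I) k velProj (X.toMap v) = v

variable (L) in
/-- The Lagrangian field equation `∑_A i_{X_A} (ω_L)_A = dE_L` at the points of `S`. -/
def SolvesLagrangianEquationOn [I.Boundaryless]
    (X : KVectorField (velModel k I) (VelocityBundle k I Q) k)
    (S : Set (VelocityBundle k I Q)) : Prop :=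
  ∀ v ∈ S, ∀ Z : TangentSpace (velModel k I) v,
    ∑ A : Fin k, omegaL L A v ![X.comp A v, Z] = mvfderiv (velModel k I) (energy L) v Z

/-- The field equation condition `∑_A FL* [i_{K_A} ((ω₀)_A ∘ FL)] = dE_L` at the points of `S`. -/
def FieldEquationConditionOn [I.Boundaryless]
    (K : KVectorFieldAlong (velModel k I) (covelModel k I) k (legendre L))
    (S : Set (VelocityBundle k I Q)) : Prop :=
  ∀ v ∈ S, ∀ Z : TangentSpace (velModel k I) v,
    ∑ A : Fin k, omega0 I Q A (legendre L v)
      ![K.comp A v, mfderiv (velModel k I) (covelModel k I) (legendre L) v Z] =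
    mvfderiv (velModel k I) (energy L) v Z

/-- The second-order condition `T¹ₖ(τ*_Q) ∘ K = Id` at the points of `S`. -/
def SecondOrderConditionOn
    (K : KVectorFieldAlong (velModel k I) (covelModel k I) k (legendre L))
    (S : Set (VelocityBundle k I Q)) : Prop :=
  ∀ v ∈ S, velMap (I' := I) k covelProj (K.toMap v) = v

/-- The `k`-vector field `K` along `FL` is a field operator for `L` on `S`; for `S = Set.univ`
this says that `K` is a field operator for `L`. -/
def IsFieldOperatorOn [I.Boundaryless]
    (K : KVectorFieldAlong (velModel k I) (covelModel k I) k (legendre L))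
    (S : Set (VelocityBundle k I Q)) : Prop :=
  FieldEquationConditionOn K S ∧ SecondOrderConditionOn K S

end Dynamics

end KSymplectic

end

/-!
The proof rests on the identity `(ω_L)_A = FL*(ω₀)_A` (`omegaL_apply`). Granting it, the relation
`T¹ₖ(FL) ∘ X_L = K` on `S` turns `(ω₀)_A(K_A, FL_* Z)` into `(ω_L)_A((X_L)_A, Z)`, so that the field
equation condition for `K` and the Lagrangian field equation for `X_L` are the same equation at each
point of `S`. Likewise `τ*_Q ∘ FL = τ_Q` gives
`T¹ₖ(τ*_Q) ∘ K = T¹ₖ(τ*_Q) ∘ T¹ₖ(FL) ∘ X_L = T¹ₖ(τ_Q) ∘ X_L` on `S`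
(`velMap_covelProj_velMap_legendre`), so that the second-order condition for `K` is the SOPDE
condition for `X_L`.

The identity for the 2-forms follows from `(θ_L)_A = FL*(θ₀)_A` (`thetaL_eq_pullback`), a pointwise
consequence of the chain rule, by taking exterior derivatives. This uses that the exterior
derivative, which is defined through the preferred chart at each point, commutes with pull-backs
(`extDerivForm_pullback`); in charts this is `extDeriv_pullback`. Its hypotheses are regularity
statements that are checked in bundle coordinates: `(θ₀)_A` is `∑ᵢ pᵢᴬ dqⁱ`
(`formInChart_theta0`), and the Legendre map is given by the partial derivatives of `L`
(`legendre_in_chart`), hence is smooth (`contMDiff_legendre`).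
-/

namespace KSymplectic

open Filter Set
open scoped Topology

/-! ### The exterior derivative commutes with pull-backs -/

section Naturality

variable {E H : Type*} [NormedAddCommGroup E] [NormedSpace ℝ E] [TopologicalSpace H]
  {I : ModelWithCorners ℝ E H} {M : Type*} [TopologicalSpace M] [ChartedSpace H M]
  {E' H' : Type*} [NormedAddCommGroup E'] [NormedSpace ℝ E'] [TopologicalSpace H']
  {I' : ModelWithCorners ℝ E' H'} {N : Type*} [TopologicalSpace N] [ChartedSpace H' N]

/-- Transport of a 1-form along an equality of base points: all tangent spaces are the model
space `E`. -/
theorem OneForm.apply_congr (α : OneForm I M) {x y : M} (h : x = y) (v : E) :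
    (α x : E →L[ℝ] ℝ) v = (α y : E →L[ℝ] ℝ) v := by
  subst h; rfl

theorem extChartAt_target_mem_nhds_of_mem [I.Boundaryless] {x : M} {z : E}
    (hz : z ∈ (extChartAt I x).target) : (extChartAt I x).target ∈ 𝓝 z :=
  (isOpen_extChartAt_target x).mem_nhds hz

theorem mdifferentiableAt_extChartAt_symm [I.Boundaryless] [IsManifold I 1 M] {x : M} {z : E}
    (hz : z ∈ (extChartAt I x).target) :
    MDifferentiableAt 𝓘(ℝ, E) I (extChartAt I x).symm z := by
  have := mdifferentiableWithinAt_extChartAt_symm (I := I) hz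
  rwa [I.range_eq_univ, mdifferentiableWithinAt_univ] at this

/-- In charts, the pull-back of a 1-form is its pull-back by the coordinate expression of the
map. -/
theorem formInChart_pullback_eventuallyEq [I.Boundaryless] [I'.Boundaryless] [IsManifold I 1 M]
    [IsManifold I' 1 N] {F : M → N} {x : M}
    (hF : ∀ᶠ y in 𝓝 x, MDifferentiableAt I I' F y) (α : OneForm I' N) :
    formInChart (pullback F α : OneForm I M) x =ᶠ[𝓝 (extChartAt I x x)] fun z =>
      (formInChart α (F x) (writtenInExtChartAt I I' x F z)).compContinuousLinearMap
        (fderiv ℝ (writtenInExtChartAt I I' x F) z) := by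
  set φ := extChartAt I x with hφ
  set ψ := extChartAt I' (F x) with hψ
  have hc : ContinuousAt φ.symm (φ x) := continuousAt_extChartAt_symm x
  have hx : φ.symm (φ x) = x := extChartAt_to_inv x
  have hFx : ContinuousAt F x := hF.self_of_nhds.continuousAt
  have h1 : ∀ᶠ z in 𝓝 (φ x), MDifferentiableAt I I' F (φ.symm z) :=
    hc.eventually (by rwa [hx])
  have h2 : ∀ᶠ z in 𝓝 (φ x), F (φ.symm z) ∈ ψ.source :=
    hc.eventually (by rw [hx]; exact hFx.eventually (extChartAt_source_mem_nhds (I := I') (F x)))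
  have h3 : ∀ᶠ z in 𝓝 (φ x), z ∈ φ.target := extChartAt_target_mem_nhds x
  filter_upwards [h1, h2.eventually_nhds, h3] with z hz1 hz2 hz3
  have hz2' := hz2.self_of_nhds
  have hsymm : MDifferentiableAt 𝓘(ℝ, E) I φ.symm z := mdifferentiableAt_extChartAt_symm hz3
  have hcomp : MDifferentiableAt 𝓘(ℝ, E) I' (F ∘ φ.symm) z := hz1.comp z hsymm
  have hψd : MDifferentiableAt I' 𝓘(ℝ, E') ψ (F (φ.symm z)) :=
    mdifferentiableAt_extChartAt (by rwa [← extChartAt_source I'])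
  have hf : MDifferentiableAt 𝓘(ℝ, E) 𝓘(ℝ, E') (writtenInExtChartAt I I' x F) z :=
    hψd.comp z hcomp
  have hft : writtenInExtChartAt I I' x F z ∈ ψ.target := ψ.map_source hz2'
  have hψs : MDifferentiableAt 𝓘(ℝ, E') I' ψ.symm (writtenInExtChartAt I I' x F z) :=
    mdifferentiableAt_extChartAt_symm hft
  -- The chain rule for both sides of `F ∘ φ⁻¹ = ψ⁻¹ ∘ (ψ ∘ F ∘ φ⁻¹)` gives the claim.
  have heq : F ∘ φ.symm =ᶠ[𝓝 z] ψ.symm ∘ writtenInExtChartAt I I' x F := by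
    filter_upwards [hz2] with y hy
    exact (ψ.left_inv hy).symm
  have hder := heq.mfderiv_eq (I := 𝓘(ℝ, E)) (I' := I')
  rw [mfderiv_comp z hz1 hsymm] at hder
  have hder2 := mfderiv_comp z hψs hf
  ext v
  have hv : (mfderiv I I' F (φ.symm z)) (mfderiv 𝓘(ℝ, E) I φ.symm z (v 0)) =
      mfderiv 𝓘(ℝ, E') I' ψ.symm (writtenInExtChartAt I I' x F z)
        (fderiv ℝ (writtenInExtChartAt I I' x F) z (v 0)) := by
    have a := DFunLike.congr_fun hder (v 0)
    have b := DFunLike.congr_fun hder2 (v 0)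
    rw [mfderiv_eq_fderiv] at b
    exact a.trans b
  have e := OneForm.apply_congr α (ψ.left_inv hz2').symm
    ((mfderiv I I' F (φ.symm z)) (mfderiv 𝓘(ℝ, E) I φ.symm z (v 0)))
  refine e.trans ?_
  exact congrArg _ hv

/-- `d(F*α) = F*(dα)`. The smoothness of `α` enters only through its chart expression at `F x`, the
one through which `extDerivForm α (F x)` is defined. -/
theorem extDerivForm_pullback [I.Boundaryless] [I'.Boundaryless] [IsManifold I 2 M]
    [IsManifold I' 2 N] {F : M → N} {x : M} (hF : ContMDiffAt I I' 2 F x) {α : OneForm I' N}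
    (hα : DifferentiableAt ℝ (formInChart α (F x)) (extChartAt I' (F x) (F x)))
    (v : Fin 2 → TangentSpace I x) :
    extDerivForm (pullback F α : OneForm I M) x v =
      extDerivForm α (F x) fun i => mfderiv I I' F x (v i) := by
  have : IsManifold I 1 M := .of_le (n := 2) (by norm_num)
  have : IsManifold I' 1 N := .of_le (n := 2) (by norm_num)
  have hFd : ∀ᶠ y in 𝓝 x, MDifferentiableAt I I' F y :=
    ((contMDiffAt_iff_contMDiffAt_nhds (by simp)).1 hF).mono fun y hy =>
      hy.mdifferentiableAt (by norm_num)
  have hval : writtenInExtChartAt I I' x F (extChartAt I x x) = extChartAt I' (F x) (F x) := by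
    simp [writtenInExtChartAt]
  have hf : ContDiffAt ℝ 2 (writtenInExtChartAt I I' x F) (extChartAt I x x) := by
    have := (contMDiffAt_iff.1 hF).2
    rwa [I.range_eq_univ, contDiffWithinAt_univ] at this
  -- The commutation of `d` with pull-backs on the model spaces, for the chart expressions.
  have hpull := extDeriv_pullback (hval.symm ▸ hα) hf (by simp)
  have hx := hFd.self_of_nhds
  have hmf : mfderiv I I' F x = fderiv ℝ (writtenInExtChartAt I I' x F) (extChartAt I x x) := by
    refine hx.mfderiv.trans ?_
    rw [I.range_eq_univ, fderivWithin_univ]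
  -- The charts at `x` and `F x` have the identity as derivative at these points, so that they drop
  -- out of the definition of `extDerivForm`.
  unfold extDerivForm
  rw [(formInChart_pullback_eventuallyEq hFd α).extDeriv_eq, hpull, hval]
  rw [mfderiv_extChartAt_self, mfderiv_extChartAt_self, hmf]
  rfl

end Naturality

/-! ### Bundle charts and canonical maps of velocities and covelocities -/

section Charts

variable {E H : Type*} [NormedAddCommGroup E] [NormedSpace ℝ E] [TopologicalSpace H]
  {k : ℕ} {I : ModelWithCorners ℝ E H} {Q : Type*} [TopologicalSpace Q] [ChartedSpace H Q]
  [IsManifold I ∞ Q]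

/-- Covectors are transported by the transpose of the inverse coordinate change of the base, as in
the definition of the dual bundle. -/
theorem covelocity_trivializationAt_apply (q : Q) (p : CovelocityBundle k I Q) (A : Fin k)
    (w : E) :
    (trivializationAt (Fin k → E →L[ℝ] ℝ) (CovelocitySpace k I) q p).2 A w =
      p.snd A (tangentCoordChange I q p.proj p.proj w) :=
  rfl

theorem velocity_extChartAt_apply (v₀ v : VelocityBundle k I Q) :
    extChartAt (velModel k I) v₀ v = (extChartAt I v₀.proj v.proj,
      diagMap k (tangentCoordChange I v.proj v₀.proj v.proj) (velTuple v)) := by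
  rw [FiberBundle.extChartAt]
  rfl

theorem covelocity_extChartAt_apply (p₀ p : CovelocityBundle k I Q) :
    extChartAt (covelModel k I) p₀ p = (extChartAt I p₀.proj p.proj,
      (trivializationAt (Fin k → E →L[ℝ] ℝ) (CovelocitySpace k I) p₀.proj p).2) := by
  rw [FiberBundle.extChartAt]
  rfl

theorem mem_velocity_extChartAt_source (v₀ v : VelocityBundle k I Q) :
    v ∈ (extChartAt (velModel k I) v₀).source ↔ v.proj ∈ (extChartAt I v₀.proj).source := by
  rw [FiberBundle.extChartAt]
  simp only [PartialEquiv.trans_source, mem_inter_iff, mem_preimage, PartialEquiv.prod_source,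
    mem_prod, extChartAt_source, Trivialization.mem_source]
  exact ⟨fun h => h.2.1, fun h => ⟨h, h, trivial⟩⟩

theorem mem_covelocity_extChartAt_source (v₀ v : CovelocityBundle k I Q) :
    v ∈ (extChartAt (covelModel k I) v₀).source ↔ v.proj ∈ (extChartAt I v₀.proj).source := by
  rw [FiberBundle.extChartAt]
  simp only [PartialEquiv.trans_source, mem_inter_iff, mem_preimage, PartialEquiv.prod_source,
    mem_prod, extChartAt_source, Trivialization.mem_source]
  exact ⟨fun h => h.2.1, fun h => ⟨h, h, trivial⟩⟩

theorem contMDiff_velProj : ContMDiff (velModel k I) I ∞ (velProj : VelocityBundle k I Q → Q) :=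
  contMDiff_proj _

theorem contMDiff_cotProj : ContMDiff (cotModel I) I ∞ (cotProj : Cotangent I Q → Q) :=
  contMDiff_proj _

theorem contMDiff_covelProj :
    ContMDiff (covelModel k I) I ∞ (covelProj : CovelocityBundle k I Q → Q) :=
  contMDiff_proj _

theorem contMDiff_covelComponent (A : Fin k) :
    ContMDiff (covelModel k I) (cotModel I) ∞
      (covelComponent A : CovelocityBundle k I Q → Cotangent I Q) := by
  intro p
  rw [contMDiffAt_totalSpace]
  refine ⟨contMDiff_covelProj p, ?_⟩
  have h := (contMDiffAt_totalSpace.1 (contMDiffAt_id (I := covelModel k I) (x := p) (n := ∞))).2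
  exact (ContinuousLinearMap.proj (R := ℝ)
    (φ := fun _ : Fin k => E →L[ℝ] ℝ) A).contMDiff.contMDiffAt.comp p h

/-- Read in the trivialization at `q`, the inclusion of the fibre over `q` is a constant paired with
a linear map. -/
theorem contMDiff_fibreInclusion (q : Q) :
    ContMDiff 𝓘(ℝ, Fin k → E) (velModel k I) ∞
      (fun u : Fin k → E => (⟨q, u⟩ : VelocityBundle k I Q)) := by
  intro u
  rw [contMDiffAt_totalSpace]
  refine ⟨contMDiffAt_const, ?_⟩
  exact (diagMap k (tangentCoordChange I q q q)).contMDiff.contMDiffAt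

end Charts

/-! ### The Liouville forms in canonical coordinates -/

section Liouville

variable {E H : Type*} [NormedAddCommGroup E] [NormedSpace ℝ E] [TopologicalSpace H]
  {k : ℕ} {I : ModelWithCorners ℝ E H} {Q : Type*} [TopologicalSpace Q] [ChartedSpace H Q]
  [IsManifold I ∞ Q]

/-- `(θ₀)_A(p) = p_A ∘ (τ*_Q)_*`. -/
theorem theta0_apply (A : Fin k) (p : CovelocityBundle k I Q)
    (Z : TangentSpace (covelModel k I) p) :
    theta0 I Q A p Z = p.snd A (mfderiv (covelModel k I) I covelProj p Z) := by
  have h := mfderiv_comp p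
    ((contMDiff_cotProj (I := I) (Q := Q)).mdifferentiableAt (by simp))
    ((contMDiff_covelComponent (I := I) (Q := Q) A).mdifferentiableAt (by simp))
  exact congrArg (p.snd A) (DFunLike.congr_fun h Z).symm

/-- In the canonical coordinates `(q, p)` of `(T¹ₖ)*Q`, `(θ₀)_A = ∑ᵢ pᵢᴬ dqⁱ`. -/
theorem formInChart_theta0 [I.Boundaryless] (A : Fin k) (p₀ : CovelocityBundle k I Q)
    {z : E × (Fin k → E →L[ℝ] ℝ)} (hz : z ∈ (extChartAt (covelModel k I) p₀).target) :
    formInChart (theta0 I Q A) p₀ z = ContinuousAlternatingMap.ofSubsingleton ℝ _ ℝ (0 : Fin 1)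
      ((z.2 A).comp (ContinuousLinearMap.fst ℝ E (Fin k → E →L[ℝ] ℝ))) := by
  set φ := extChartAt (covelModel k I) p₀ with hφ
  set p := φ.symm z with hp
  set χ := extChartAt I p₀.proj with hχ
  have hpz : φ p = z := φ.right_inv hz
  have hpq : p.proj ∈ χ.source :=
    (mem_covelocity_extChartAt_source p₀ p).1 (φ.map_target hz)
  have hpc := covelocity_extChartAt_apply p₀ p
  rw [← hφ, hpz] at hpc
  have hsymm : MDifferentiableAt 𝓘(ℝ, E × (Fin k → E →L[ℝ] ℝ)) (covelModel k I) φ.symm z :=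
    mdifferentiableAt_extChartAt_symm hz
  have hproj : MDifferentiableAt (covelModel k I) I (covelProj : CovelocityBundle k I Q → Q) p :=
    contMDiff_covelProj.mdifferentiableAt (by simp)
  have hχd : MDifferentiableAt I 𝓘(ℝ, E) χ (covelProj p) :=
    mdifferentiableAt_extChartAt (by rwa [← extChartAt_source I])
  -- In the bundle chart, the projection to the base is the first projection.
  have hev : χ ∘ (covelProj ∘ φ.symm) =ᶠ[𝓝 z] Prod.fst := by
    filter_upwards [extChartAt_target_mem_nhds_of_mem hz] with y hy
    have := covelocity_extChartAt_apply p₀ (φ.symm y)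
    rw [← hφ, φ.right_inv hy] at this
    exact (congrArg Prod.fst this).symm
  have hder := hev.mfderiv_eq (I := 𝓘(ℝ, E × (Fin k → E →L[ℝ] ℝ))) (I' := 𝓘(ℝ, E))
  have hps : MDifferentiableAt 𝓘(ℝ, E × (Fin k → E →L[ℝ] ℝ)) I (covelProj ∘ φ.symm) z :=
    hproj.comp z hsymm
  rw [mfderiv_comp z (f := covelProj ∘ φ.symm) hχd hps, mfderiv_comp z hproj hsymm] at hder
  ext v
  have hd := DFunLike.congr_fun hder (v 0)
  have hfst : mfderiv 𝓘(ℝ, E × (Fin k → E →L[ℝ] ℝ)) 𝓘(ℝ, E) Prod.fst z (v 0) = (v 0).1 := by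
    rw [mfderiv_eq_fderiv, fderiv_fst]; rfl
  have hd' := hd.trans hfst
  -- `Y` is the projection to the base of the coordinate vector `v 0`; its components in the chart
  -- at the base point of `p₀` are `(v 0).1`.
  let Y : E := mfderiv (covelModel k I) I covelProj p (mfderiv 𝓘(ℝ, E × (Fin k → E →L[ℝ] ℝ))
    (covelModel k I) φ.symm z (v 0))
  have hχY : tangentCoordChange I p.proj p₀.proj p.proj Y = (v 0).1 := by
    have hs : p.proj ∈ (chartAt H p₀.proj).source := by rwa [← extChartAt_source I]
    have h := (hasMFDerivAt_extChartAt (I := I) hs).mfderiv.trans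
      (mfderiv_chartAt_eq_tangentCoordChange hs)
    exact (DFunLike.congr_fun h Y).symm.trans hd'
  have hz2 : z.2 A (v 0).1 = p.snd A (tangentCoordChange I p₀.proj p.proj p.proj (v 0).1) := by
    rw [hpc]; rfl
  have hYeq : tangentCoordChange I p₀.proj p.proj p.proj (v 0).1 = Y := by
    rw [← hχY, tangentCoordChange_comp, tangentCoordChange_self]
    · exact mem_extChartAt_source _
    · exact ⟨⟨mem_extChartAt_source _, hpq⟩, mem_extChartAt_source _⟩
  refine (theta0_apply A p
    (mfderiv 𝓘(ℝ, E × (Fin k → E →L[ℝ] ℝ)) (covelModel k I) φ.symm z (v 0))).trans ?_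
  exact ((congrArg (p.snd A) hYeq).symm.trans hz2.symm)

set_option synthInstance.maxHeartbeats 200000 in
theorem differentiableAt_formInChart_theta0 [I.Boundaryless] (A : Fin k)
    (p : CovelocityBundle k I Q) :
    DifferentiableAt ℝ (formInChart (theta0 I Q A) p) (extChartAt (covelModel k I) p p) := by
  have hev : formInChart (theta0 I Q A) p =ᶠ[𝓝 (extChartAt (covelModel k I) p p)] fun z =>
      ContinuousAlternatingMap.ofSubsingletonLIE (𝕜 := ℝ) (E := E × (Fin k → E →L[ℝ] ℝ))
        (F := ℝ) (0 : Fin 1) ((z.2 A).comp (ContinuousLinearMap.fst ℝ E (Fin k → E →L[ℝ] ℝ))) := by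
    filter_upwards [extChartAt_target_mem_nhds p] with z hz
    exact formInChart_theta0 A p hz
  refine DifferentiableAt.congr_of_eventuallyEq ?_ hev
  fun_prop

end Liouville

/-! ### The Legendre map in coordinates -/

section Legendre

variable {E H : Type*} [NormedAddCommGroup E] [NormedSpace ℝ E] [TopologicalSpace H]
  {k : ℕ} {I : ModelWithCorners ℝ E H} {Q : Type*} [TopologicalSpace Q] [ChartedSpace H Q]
  [IsManifold I ∞ Q]
  {L : VelocityBundle k I Q → ℝ}

theorem contDiffOn_comp_extChartAt_symm [I.Boundaryless]
    (hL : ContMDiff (velModel k I) 𝓘(ℝ, ℝ) ∞ L) (v₀ : VelocityBundle k I Q) :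
    ContDiffOn ℝ ∞ (L ∘ (extChartAt (velModel k I) v₀).symm)
      (extChartAt (velModel k I) v₀).target := by
  rw [← contMDiffOn_iff_contDiffOn]
  exact hL.comp_contMDiffOn (contMDiffOn_extChartAt_symm v₀)

/-- In the coordinates `(q, v)` of `T¹ₖQ`, the components of the Legendre map are the partial
derivatives `∂L/∂v_A`. -/
theorem legendre_in_chart [I.Boundaryless] (hL : ContMDiff (velModel k I) 𝓘(ℝ, ℝ) ∞ L)
    {v₀ v : VelocityBundle k I Q} (hv : v ∈ (extChartAt (velModel k I) v₀).source) (A : Fin k) :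
    (trivializationAt (Fin k → E →L[ℝ] ℝ) (CovelocitySpace k I) v₀.proj (legendre L v)).2 A =
      (fderiv ℝ (L ∘ (extChartAt (velModel k I) v₀).symm) (extChartAt (velModel k I) v₀ v)).comp
        ((ContinuousLinearMap.inr ℝ E (Fin k → E)).comp
          (ContinuousLinearMap.single ℝ (fun _ : Fin k => E) A)) := by
  set φ := extChartAt (velModel k I) v₀ with hφ
  set T := tangentCoordChange I v.proj v₀.proj v.proj with hT
  have hq : v.proj ∈ (extChartAt I v₀.proj).source := (mem_velocity_extChartAt_source v₀ v).1 hv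
  have hg : DifferentiableAt ℝ (L ∘ φ.symm) (φ v) :=
    ((contDiffOn_comp_extChartAt_symm hL v₀).contDiffAt
      (extChartAt_target_mem_nhds_of_mem (φ.map_source hv))).differentiableAt (by simp)
  -- In the coordinates around `v₀`, the fibre through `v` is an affine slice, parametrized by the
  -- linear map `T` on each of the `k` summands.
  have hfib : (fun u : Fin k → E => L ⟨v.proj, u⟩) =
      fun u => (L ∘ φ.symm) (extChartAt I v₀.proj v.proj, diagMap k T u) := by
    funext u
    have hu : (⟨v.proj, u⟩ : VelocityBundle k I Q) ∈ φ.source :=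
      (mem_velocity_extChartAt_source v₀ _).2 hq
    have h := velocity_extChartAt_apply v₀ (⟨v.proj, u⟩ : VelocityBundle k I Q)
    have h' := φ.left_inv hu
    rw [h] at h'
    exact congrArg L h'.symm
  have hφv : φ v = (extChartAt I v₀.proj v.proj, diagMap k T (velTuple v)) :=
    velocity_extChartAt_apply v₀ v
  have hin : HasFDerivAt (fun u : Fin k → E => (extChartAt I v₀.proj v.proj, diagMap k T u))
      ((ContinuousLinearMap.inr ℝ E (Fin k → E)).comp (diagMap k T)) (velTuple v) :=
    (hasFDerivAt_const _ _).prodMk (diagMap k T).hasFDerivAt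
  have hder : fderiv ℝ (fun u : Fin k → E => L ⟨v.proj, u⟩) (velTuple v) =
      (fderiv ℝ (L ∘ φ.symm) (φ v)).comp
        ((ContinuousLinearMap.inr ℝ E (Fin k → E)).comp (diagMap k T)) := by
    rw [hfib]
    rw [hφv] at hg ⊢
    exact (hg.hasFDerivAt.comp (velTuple v) hin).fderiv
  ext w
  rw [covelocity_trivializationAt_apply]
  -- The covector is transported by the inverse of `T`, which cancels the factor `T`.
  have hs : diagMap k T (Pi.single A (tangentCoordChange I v₀.proj v.proj v.proj w)) =
      Pi.single A w := by
    have hTw : T (tangentCoordChange I v₀.proj v.proj v.proj w) = w := by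
      rw [hT, tangentCoordChange_comp, tangentCoordChange_self hq]
      exact ⟨⟨hq, mem_extChartAt_source _⟩, hq⟩
    funext B
    rcases eq_or_ne B A with rfl | hB
    · simpa [diagMap] using hTw
    · simp [diagMap, hB]
  have e := DFunLike.congr_fun hder
    (Pi.single A (tangentCoordChange I v₀.proj v.proj v.proj w))
  refine e.trans ?_
  exact congrArg (fun u => fderiv ℝ (L ∘ φ.symm) (φ v) ((0 : E), u)) hs

theorem contMDiff_legendre [I.Boundaryless] (hL : ContMDiff (velModel k I) 𝓘(ℝ, ℝ) ∞ L) :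
    ContMDiff (velModel k I) (covelModel k I) ∞ (legendre L) := by
  intro v₀
  rw [contMDiffAt_totalSpace]
  refine ⟨contMDiff_velProj v₀, ?_⟩
  rw [contMDiffAt_pi_space]
  intro A
  set φ := extChartAt (velModel k I) v₀ with hφ
  have hg : ContDiffAt ℝ ∞ (fderiv ℝ (L ∘ φ.symm)) (φ v₀) :=
    ((contDiffOn_comp_extChartAt_symm hL v₀).contDiffAt
      (extChartAt_target_mem_nhds v₀)).fderiv_right (by simp)
  have hg' : ContDiffAt ℝ ∞ (fun z => (fderiv ℝ (L ∘ φ.symm) z).comp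
      ((ContinuousLinearMap.inr ℝ E (Fin k → E)).comp
        (ContinuousLinearMap.single ℝ (fun _ : Fin k => E) A))) (φ v₀) :=
    hg.clm_comp contDiffAt_const
  refine (hg'.contMDiffAt.comp v₀
    (contMDiffAt_extChartAt (I := velModel k I) (n := ∞))).congr_of_eventuallyEq ?_
  filter_upwards [extChartAt_source_mem_nhds (I := velModel k I) v₀] with v hv
  exact legendre_in_chart hL hv A

end Legendre

/-! ### Pulling back the canonical structures by the Legendre map -/

section Dynamics

variable {E H : Type*} [NormedAddCommGroup E] [NormedSpace ℝ E] [TopologicalSpace H]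
  {k : ℕ} {I : ModelWithCorners ℝ E H} {Q : Type*} [TopologicalSpace Q] [ChartedSpace H Q]
  [IsManifold I ∞ Q]
  {L : VelocityBundle k I Q → ℝ}

/-- `dL` evaluated on the vertical `A`-lift of `X` is the pairing of `FL(v)ᴬ` with `X`. -/
theorem mvfderiv_verticalLift (hL : ContMDiff (velModel k I) 𝓘(ℝ, ℝ) ∞ L) (A : Fin k)
    (v : VelocityBundle k I Q) (X : TangentSpace I (velProj v)) :
    mvfderiv (velModel k I) L v (verticalLift A v X) = (legendre L v).snd A X := by
  have h := mfderiv_comp (velTuple v)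
    (hL.mdifferentiableAt (x := v) (by simp))
    ((contMDiff_fibreInclusion (I := I) (k := k) v.proj).mdifferentiableAt
      (x := velTuple v) (by simp))
  rw [mfderiv_eq_fderiv] at h
  exact (DFunLike.congr_fun h (Pi.single A X : Fin k → E)).symm

/-- The Poincaré–Cartan forms are the pull-backs of the Liouville forms: `(θ_L)_A = FL*(θ₀)_A`. -/
theorem thetaL_eq_pullback [I.Boundaryless] (hL : ContMDiff (velModel k I) 𝓘(ℝ, ℝ) ∞ L)
    (A : Fin k) :
    thetaL L A = pullback (legendre L) (theta0 I Q A) := by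
  funext v
  ext Z
  have h := mfderiv_comp v
    ((contMDiff_covelProj (I := I) (Q := Q) (k := k)).mdifferentiableAt
      (x := legendre L v) (by simp))
    ((contMDiff_legendre hL).mdifferentiableAt (x := v) (by simp))
  have e1 := mvfderiv_verticalLift hL A v (mfderiv (velModel k I) I velProj v Z)
  have e2 := theta0_apply A (legendre L v)
    (mfderiv (velModel k I) (covelModel k I) (legendre L) v Z)
  refine e1.trans (Eq.trans ?_ e2.symm)
  exact congrArg ((legendre L v).snd A) (DFunLike.congr_fun h Z)

/-- `(ω_L)_A = FL*(ω₀)_A`, by applying `-d` to `(θ_L)_A = FL*(θ₀)_A`. -/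
theorem omegaL_apply [I.Boundaryless] (hL : ContMDiff (velModel k I) 𝓘(ℝ, ℝ) ∞ L)
    (A : Fin k) (v : VelocityBundle k I Q) (Y Z : TangentSpace (velModel k I) v) :
    omegaL L A v ![Y, Z] = omega0 I Q A (legendre L v)
      ![mfderiv (velModel k I) (covelModel k I) (legendre L) v Y,
        mfderiv (velModel k I) (covelModel k I) (legendre L) v Z] := by
  have h := extDerivForm_pullback (((contMDiff_legendre hL) v).of_le ENat.LEInfty.out)
    (differentiableAt_formInChart_theta0 A (legendre L v)) ![Y, Z]
  rw [← thetaL_eq_pullback hL] at h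
  have hv : (fun i => mfderiv (velModel k I) (covelModel k I) (legendre L) v (![Y, Z] i)) =
      ![mfderiv (velModel k I) (covelModel k I) (legendre L) v Y,
        mfderiv (velModel k I) (covelModel k I) (legendre L) v Z] := by
    funext i; fin_cases i <;> rfl
  rw [hv] at h
  exact congrArg Neg.neg h

/-- Since `τ*_Q ∘ FL = τ_Q`, the base components of `T¹ₖ(FL)(X)` are those of `X`. -/
theorem velMap_covelProj_velMap_legendre [I.Boundaryless]
    (hL : ContMDiff (velModel k I) 𝓘(ℝ, ℝ) ∞ L)
    (x : VelocityBundle k (velModel k I) (VelocityBundle k I Q)) :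
    velMap (I' := I) k covelProj (velMap k (legendre L) x :
      VelocityBundle k (covelModel k I) (CovelocityBundle k I Q)) =
      velMap (I' := I) k velProj x := by
  have h := mfderiv_comp x.proj
    ((contMDiff_covelProj (I := I) (Q := Q) (k := k)).mdifferentiableAt
      (x := legendre L x.proj) (by simp))
    ((contMDiff_legendre hL).mdifferentiableAt (x := x.proj) (by simp))
  have e : (fun A => mfderiv (covelModel k I) I covelProj (legendre L x.proj)
      (mfderiv (velModel k I) (covelModel k I) (legendre L) x.proj (x.snd A))) =
      fun A => mfderiv (velModel k I) I velProj x.proj (x.snd A) := by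
    funext A
    exact (DFunLike.congr_fun h (x.snd A)).symm
  exact congrArg (fun w => (⟨x.proj.proj, w⟩ : VelocityBundle k I Q)) e

end Dynamics

end KSymplectic

theorem mainTheorem3 (n k : ℕ) {Q : Type*} [TopologicalSpace Q]
    [ChartedSpace (EuclideanSpace ℝ (Fin n)) Q] [IsManifold (𝓡 n) ∞ Q]
    (L : KSymplectic.VelocityBundle k (𝓡 n) Q → ℝ)
    (hL : ContMDiff (KSymplectic.velModel k (𝓡 n)) 𝓘(ℝ, ℝ) ∞ L)
    (K : KSymplectic.KVectorFieldAlong (KSymplectic.velModel k (𝓡 n))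
      (KSymplectic.covelModel k (𝓡 n)) k (KSymplectic.legendre L))
    (X : KSymplectic.KVectorField (KSymplectic.velModel k (𝓡 n))
      (KSymplectic.VelocityBundle k (𝓡 n) Q) k)
    (S : Set (KSymplectic.VelocityBundle k (𝓡 n) Q))
    (hKX : ∀ v ∈ S, KSymplectic.velMap k (KSymplectic.legendre L) (X.toMap v) = K.toMap v) :
    KSymplectic.IsFieldOperatorOn K S ↔
      KSymplectic.IsSopdeOn X S ∧ KSymplectic.SolvesLagrangianEquationOn L X S := by
  rw [and_comm]
  refine and_congr (forall₂_congr fun v hv => ?_) (forall₂_congr fun v hv => ?_)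
  · refine forall_congr' fun Z => ?_
    have hK : ∀ A, K.comp A v = mfderiv (KSymplectic.velModel k (𝓡 n))
        (KSymplectic.covelModel k (𝓡 n)) (KSymplectic.legendre L) v (X.comp A v) := by
      intro A
      have h := hKX v hv
      exact (congrFun (eq_of_heq (TotalSpace.mk.inj h).2) A).symm
    simp only [hK, KSymplectic.omegaL_apply hL]
  · rw [← hKX v hv, KSymplectic.velMap_covelProj_velMap_legendre hL]
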